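/- Let $(\Omega,\mathcal F)$ be a measurable space and let $\mathfrak P$ be a nonempty set of probability measures on $(\Omega,\mathcal F)$. Put $\mathbf c(A)=\sup_{\mathbb P\in\mathfrak P}\mathbb P(A)$ for $A\in\mathcal F$; an event $A$ is polar if $\mathbf c(A)=0$, and a property holds quasi surely if it holds outside a polar event. $\mathfrak P$ is dominated if there is a probability measure $\mathbb Q$ on $(\Omega,\mathcal F)$ such that every $N\in\mathcal F$ with $\mathbb Q(N)=0$ is polar. Let $L^0_{\mathbf c}$ be the vector lattice of measurable functions $f\colon\Omega\to\mathbb R$ modulo quasi-sure equality, with the quasi-sure order $\preceq$, and let $L^\infty_{\mathbf c}=\{X\in L^0_{\mathbf c}\mid \exists\, m>0:\ |X|\preceq m\mathbf 1_\Omega\}$. An ideal of $L^0_{\mathbf c}$ is a linear subspace $\mathcal X$ such that $y\in\mathcal X$, $x\in L^0_{\mathbf c}$ and $|x|\preceq|y|$ imply $x\in\mathcal X$; it is a vector lattice with the order inherited from $L^0_{\mathbf c}$. A locally convex-solid Hausdorff topology on a vector lattice is a Hausdorff vector space topology that is locally convex and has a base of neighbourhoods of $0$ consisting of solid sets. A vector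 lattice $\mathcal X$ with such a topology $\tau$ has the Kreps–Yan property if for every convex cone $\mathcal C\subset\mathcal X$ with $-\mathcal X_+\subset\mathcal C$ and $\overline{\mathcal C}^{\,\tau}\cap\mathcal X_+=\{0\}$ there is a $\tau$-continuous linear functional $\xi\colon\mathcal X\to\mathbb R$ with $\xi(x)>0$ for all $x\in\mathcal X_+\setminus\{0\}$ and $\xi(x)\le 0$ for all $x\in\mathcal C$. Let $\mathcal X$ be an ideal of $L^0_{\mathbf c}$ with $L^\infty_{\mathbf c}\subset\mathcal X$. (a) Suppose $\|\cdot\|_{\mathcal X}$ is a norm on $\mathcal X$ for which $(\mathcal X,\preceq,\|\cdot\|_{\mathcal X})$ is a Banach lattice (i.e. the norm is complete, and $|x|\preceq|y|$ implies $\|x\|_{\mathcal X}\le\|y\|_{\mathcal X}$). Then $\mathfrak P$ is dominated if and only if $\mathcal X$ with its norm topology has the Kreps–Yan property. (b) Suppose $\tau$ is a locally convex-solid Hausdorff topology on $\mathcal X$ and $(\mathcal X,\tau)$ has the Kreps–Yan property. Then $\mathfrak P$ is dominated. -/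

import Mathlib

open MeasureTheory

noncomputable section

/-! ### Quasi-sure analysis for a set of probability measures -/

namespace QuasiSure

variable {Ω : Type*} [MeasurableSpace Ω]

/-- The upper probability `c(A) = sup_{P ∈ 𝔓} P(A)`. -/
def upperProb (𝔓 : Set (ProbabilityMeasure Ω)) (A : Set Ω) : ENNReal :=
  ⨆ P ∈ 𝔓, (P : Measure Ω) A

/-- An event is polar if its upper probability vanishes. -/
def IsPolar (𝔓 : Set (ProbabilityMeasure Ω)) (A : Set Ω) : Prop :=
  MeasurableSet A ∧ upperProb 𝔓 A = 0

/-- A property holds quasi surely if it holds outside a polar event. -/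
def QS (𝔓 : Set (ProbabilityMeasure Ω)) (p : Ω → Prop) : Prop :=
  ∃ N, IsPolar 𝔓 N ∧ ∀ ω, ω ∉ N → p ω

/-- `𝔓` is dominated: some probability measure `Q` on the same measurable space is such that every
`Q`-null event is polar. -/
def Dominated (𝔓 : Set (ProbabilityMeasure Ω)) : Prop :=
  ∃ Q : ProbabilityMeasure Ω, ∀ N, MeasurableSet N → (Q : Measure Ω) N = 0 → upperProb 𝔓 N = 0

variable {𝔓 : Set (ProbabilityMeasure Ω)}

theorem upperProb_mono {A B : Set Ω} (h : A ⊆ B) : upperProb 𝔓 A ≤ upperProb 𝔓 B :=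
  iSup₂_mono fun _ _ => measure_mono h

theorem IsPolar.union {A B : Set Ω} (hA : IsPolar 𝔓 A) (hB : IsPolar 𝔓 B) :
    IsPolar 𝔓 (A ∪ B) := by
  refine ⟨hA.1.union hB.1, ?_⟩
  have h1 := hA.2
  have h2 := hB.2
  simp only [upperProb, ENNReal.iSup_eq_zero] at h1 h2 ⊢
  exact fun P hP => measure_union_null (h1 P hP) (h2 P hP)

theorem QS.of_forall {p : Ω → Prop} (h : ∀ ω, p ω) : QS 𝔓 p :=
  ⟨∅, ⟨MeasurableSet.empty, by simp [upperProb]⟩, fun ω _ => h ω⟩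

theorem QS.mono {p q : Ω → Prop} (hp : QS 𝔓 p) (h : ∀ ω, p ω → q ω) : QS 𝔓 q := by
  obtain ⟨N, hN, hp⟩ := hp
  exact ⟨N, hN, fun ω hω => h ω (hp ω hω)⟩

theorem QS.and {p q : Ω → Prop} (hp : QS 𝔓 p) (hq : QS 𝔓 q) : QS 𝔓 (fun ω => p ω ∧ q ω) := by
  obtain ⟨N, hN, hp⟩ := hp
  obtain ⟨M, hM, hq⟩ := hq
  refine ⟨N ∪ M, hN.union hM, fun ω hω => ⟨hp ω ?_, hq ω ?_⟩⟩
  · exact fun h => hω (Or.inl h)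
  · exact fun h => hω (Or.inr h)

variable (Ω) in
/-- The space `𝓛⁰` of real-valued random variables. -/
def MeasurableFun : Submodule ℝ (Ω → ℝ) where
  carrier := {f | Measurable f}
  zero_mem' := measurable_const
  add_mem' hf hg := Measurable.add hf hg
  smul_mem' c _ hf := Measurable.const_smul hf c

theorem qs_eq_zero_iff {f : Ω → ℝ} (hf : Measurable f) :
    upperProb 𝔓 {ω | 0 < |f ω|} = 0 ↔ QS 𝔓 (fun ω => f ω = 0) := by
  constructor
  · intro h
    refine ⟨_, ⟨measurableSet_lt measurable_const (_root_.measurable_abs.comp hf), h⟩, ?_⟩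
    intro ω hω
    simpa using hω
  · rintro ⟨N, hN, h⟩
    refine le_antisymm ((upperProb_mono ?_).trans hN.2.le) (zero_le)
    intro ω hω
    by_contra hn
    simp [h ω hn] at hω

/-- The space `𝓝 = {f ∈ 𝓛⁰ | c(|f| > 0) = 0}`. -/
def nullFun (𝔓 : Set (ProbabilityMeasure Ω)) : Submodule ℝ (MeasurableFun Ω) where
  carrier := {f | upperProb 𝔓 {ω | 0 < |f.1 ω|} = 0}
  zero_mem' := by simp [upperProb]
  add_mem' {f g} hf hg := by
    have hf' := (qs_eq_zero_iff f.2).1 hf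
    have hg' := (qs_eq_zero_iff g.2).1 hg
    refine (qs_eq_zero_iff (f + g).2).2 ((hf'.and hg').mono ?_)
    rintro ω ⟨h1, h2⟩
    simp [h1, h2]
  smul_mem' c f hf := by
    have hf' := (qs_eq_zero_iff f.2).1 hf
    refine (qs_eq_zero_iff (c • f).2).2 (hf'.mono ?_)
    intro ω h
    simp [h]

/-- The space `L⁰_c = 𝓛⁰ / 𝓝` of random variables up to quasi-sure equality. -/
def L0 (𝔓 : Set (ProbabilityMeasure Ω)) : Type _ := MeasurableFun Ω ⧸ nullFun 𝔓

namespace L0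

instance : AddCommGroup (L0 𝔓) := inferInstanceAs (AddCommGroup (MeasurableFun Ω ⧸ nullFun 𝔓))

instance : Module ℝ (L0 𝔓) := inferInstanceAs (Module ℝ (MeasurableFun Ω ⧸ nullFun 𝔓))

/-- The equivalence class `[f]` of a random variable. -/
def mk (𝔓 : Set (ProbabilityMeasure Ω)) : MeasurableFun Ω →ₗ[ℝ] L0 𝔓 := (nullFun 𝔓).mkQ

theorem mk_surjective : Function.Surjective (mk 𝔓) := (nullFun 𝔓).mkQ_surjective

theorem mk_eq_mk {f g : MeasurableFun Ω} :
    mk 𝔓 f = mk 𝔓 g ↔ QS 𝔓 (fun ω => f.1 ω = g.1 ω) := by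
  have h : mk 𝔓 f = mk 𝔓 g ↔ f - g ∈ nullFun 𝔓 := Submodule.Quotient.eq (nullFun 𝔓)
  rw [h]
  refine (qs_eq_zero_iff (f - g).2).trans ?_
  simp [sub_eq_zero]

/-- The quasi-sure order: `X ≤ Y` if `f ≤ g` quasi surely for all representatives `f ∈ X`,
`g ∈ Y`. -/
instance : LE (L0 𝔓) :=
  ⟨fun X Y => ∀ f g, mk 𝔓 f = X → mk 𝔓 g = Y → QS 𝔓 (fun ω => f.1 ω ≤ g.1 ω)⟩

theorem mk_le_mk {f g : MeasurableFun Ω} :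
    mk 𝔓 f ≤ mk 𝔓 g ↔ QS 𝔓 (fun ω => f.1 ω ≤ g.1 ω) := by
  constructor
  · exact fun h => h f g rfl rfl
  · intro h f' g' hf hg
    refine (((mk_eq_mk.1 hf).and (mk_eq_mk.1 hg)).and h).mono ?_
    rintro ω ⟨⟨h1, h2⟩, h3⟩
    rw [h1, h2]
    exact h3

instance : PartialOrder (L0 𝔓) where
  le := (· ≤ ·)
  le_refl X := by
    obtain ⟨f, rfl⟩ := mk_surjective X
    exact mk_le_mk.2 (QS.of_forall fun _ => le_rfl)
  le_trans X Y Z := by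
    obtain ⟨f, rfl⟩ := mk_surjective X
    obtain ⟨g, rfl⟩ := mk_surjective Y
    obtain ⟨k, rfl⟩ := mk_surjective Z
    intro h1 h2
    exact mk_le_mk.2 (((mk_le_mk.1 h1).and (mk_le_mk.1 h2)).mono fun _ h => h.1.trans h.2)
  le_antisymm X Y := by
    obtain ⟨f, rfl⟩ := mk_surjective X
    obtain ⟨g, rfl⟩ := mk_surjective Y
    intro h1 h2
    exact mk_eq_mk.2 (((mk_le_mk.1 h1).and (mk_le_mk.1 h2)).mono fun _ h => le_antisymm h.1 h.2)

/-- Pointwise maximum of random variables. -/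
def funSup (f g : MeasurableFun Ω) : MeasurableFun Ω := ⟨fun ω => f.1 ω ⊔ g.1 ω, f.2.sup g.2⟩

/-- Pointwise minimum of random variables. -/
def funInf (f g : MeasurableFun Ω) : MeasurableFun Ω := ⟨fun ω => f.1 ω ⊓ g.1 ω, f.2.inf g.2⟩

/-- Maximum and minimum in `L⁰_c` are the classes of the pointwise maximum and minimum of (any)
representatives. -/
instance : Lattice (L0 𝔓) where
  sup X Y := mk 𝔓 (funSup (mk_surjective X).choose (mk_surjective Y).choose)
  inf X Y := mk 𝔓 (funInf (mk_surjective X).choose (mk_surjective Y).choose)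
  le_sup_left X Y := by
    nth_rw 1 [← (mk_surjective X).choose_spec]
    exact mk_le_mk.2 (QS.of_forall fun _ => le_sup_left)
  le_sup_right X Y := by
    nth_rw 1 [← (mk_surjective Y).choose_spec]
    exact mk_le_mk.2 (QS.of_forall fun _ => le_sup_right)
  sup_le X Y Z h1 h2 := by
    rw [← (mk_surjective X).choose_spec, ← (mk_surjective Z).choose_spec] at h1
    rw [← (mk_surjective Y).choose_spec, ← (mk_surjective Z).choose_spec] at h2
    rw [← (mk_surjective Z).choose_spec]
    exact mk_le_mk.2 (((mk_le_mk.1 h1).and (mk_le_mk.1 h2)).mono fun _ h => sup_le h.1 h.2)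
  inf_le_left X Y := by
    nth_rw 3 [← (mk_surjective X).choose_spec]
    exact mk_le_mk.2 (QS.of_forall fun _ => inf_le_left)
  inf_le_right X Y := by
    nth_rw 3 [← (mk_surjective Y).choose_spec]
    exact mk_le_mk.2 (QS.of_forall fun _ => inf_le_right)
  le_inf X Y Z h1 h2 := by
    rw [← (mk_surjective X).choose_spec, ← (mk_surjective Y).choose_spec] at h1
    rw [← (mk_surjective X).choose_spec, ← (mk_surjective Z).choose_spec] at h2
    rw [← (mk_surjective X).choose_spec]
    exact mk_le_mk.2 (((mk_le_mk.1 h1).and (mk_le_mk.1 h2)).mono fun _ h => le_inf h.1 h.2)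

theorem mk_sup_mk (f g : MeasurableFun Ω) : mk 𝔓 f ⊔ mk 𝔓 g = mk 𝔓 (funSup f g) := by
  refine le_antisymm (sup_le ?_ ?_) ?_
  · exact mk_le_mk.2 (QS.of_forall fun _ => le_sup_left)
  · exact mk_le_mk.2 (QS.of_forall fun _ => le_sup_right)
  · obtain ⟨k, hk⟩ := mk_surjective (mk 𝔓 f ⊔ mk 𝔓 g)
    have h1 : mk 𝔓 f ≤ mk 𝔓 k := hk ▸ le_sup_left
    have h2 : mk 𝔓 g ≤ mk 𝔓 k := hk ▸ le_sup_right
    rw [← hk]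
    exact mk_le_mk.2 (((mk_le_mk.1 h1).and (mk_le_mk.1 h2)).mono fun _ h => sup_le h.1 h.2)

/-- `L⁰_c` is a vector lattice (together with the next instance). -/
instance : IsOrderedAddMonoid (L0 𝔓) where
  add_le_add_left X Y h Z := by
    obtain ⟨f, rfl⟩ := mk_surjective X
    obtain ⟨g, rfl⟩ := mk_surjective Y
    obtain ⟨k, rfl⟩ := mk_surjective Z
    rw [← map_add, ← map_add]
    refine mk_le_mk.2 ((mk_le_mk.1 h).mono fun ω hω => ?_)
    simpa using hω

instance : PosSMulMono ℝ (L0 𝔓) where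
  smul_le_smul_of_nonneg_left a ha X Y h := by
    obtain ⟨f, rfl⟩ := mk_surjective X
    obtain ⟨g, rfl⟩ := mk_surjective Y
    rw [← map_smul, ← map_smul]
    refine mk_le_mk.2 ((mk_le_mk.1 h).mono fun ω hω => ?_)
    simpa using mul_le_mul_of_nonneg_left hω ha

/-- The class `1_Ω` of the constant function one. -/
instance : One (L0 𝔓) := ⟨mk 𝔓 ⟨fun _ => 1, measurable_const⟩⟩

end L0

/-- The set `L^∞_c = {X ∈ L⁰_c | ∃ m > 0, |X| ≤ m 1_Ω}`. -/
def Linfty (𝔓 : Set (ProbabilityMeasure Ω)) : Set (L0 𝔓) :=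
  {X | ∃ m : ℝ, 0 < m ∧ |X| ≤ m • (1 : L0 𝔓)}

end QuasiSure

/-! ### Ideals, Banach lattices, locally convex-solid topologies, the Kreps–Yan property -/

/-- An ideal of a vector lattice: a linear subspace `B` such that `y ∈ B` and `|x| ≤ |y|`
imply `x ∈ B`. -/
structure VectorLatticeIdeal (E : Type*) [AddCommGroup E] [Module ℝ E] [Lattice E] extends
    Submodule ℝ E where
  solid' : LatticeOrderedAddCommGroup.IsSolid carrier

namespace VectorLatticeIdeal

variable {E : Type*} [AddCommGroup E] [Module ℝ E] [Lattice E]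

instance : CoeSort (VectorLatticeIdeal E) (Type _) := ⟨fun X => X.toSubmodule⟩

theorem abs_mem (X : VectorLatticeIdeal E) [IsOrderedAddMonoid E] {x : E}
    (hx : x ∈ X.toSubmodule) : |x| ∈ X.toSubmodule :=
  X.solid' hx (abs_abs x).le

theorem sup_mem (X : VectorLatticeIdeal E) [IsOrderedAddMonoid E] {x y : E}
    (hx : x ∈ X.toSubmodule) (hy : y ∈ X.toSubmodule) : x ⊔ y ∈ X.toSubmodule := by
  refine X.solid' (X.toSubmodule.add_mem (X.abs_mem hx) (X.abs_mem hy)) ?_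
  rw [abs_of_nonneg (add_nonneg (abs_nonneg x) (abs_nonneg y))]
  refine abs_le'.2 ⟨sup_le ?_ ?_, ?_⟩
  · exact (le_abs_self x).trans (le_add_of_nonneg_right (abs_nonneg y))
  · exact (le_abs_self y).trans (le_add_of_nonneg_left (abs_nonneg x))
  · exact (neg_le_neg le_sup_left).trans
      ((neg_le_abs x).trans (le_add_of_nonneg_right (abs_nonneg y)))

theorem inf_mem (X : VectorLatticeIdeal E) [IsOrderedAddMonoid E] {x y : E}
    (hx : x ∈ X.toSubmodule) (hy : y ∈ X.toSubmodule) : x ⊓ y ∈ X.toSubmodule := by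
  have h := X.toSubmodule.neg_mem
    (X.sup_mem (X.toSubmodule.neg_mem hx) (X.toSubmodule.neg_mem hy))
  rwa [neg_sup, neg_neg, neg_neg] at h

/-- An ideal is a vector lattice for the order and the lattice operations of the ambient space. -/
instance [IsOrderedAddMonoid E] (X : VectorLatticeIdeal E) : Lattice X :=
  Subtype.lattice (fun _ _ => X.sup_mem) (fun _ _ => X.inf_mem)

end VectorLatticeIdeal

/-- The vector lattice `E` with the given norm is a Banach lattice: a norm which is monotone
in the modulus and complete. -/
structure IsBanachLattice (E : Type*) [AddCommGroup E] [Module ℝ E] [Lattice E] [Norm E] :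
    Prop where
  core : NormedSpace.Core ℝ E
  solid : ∀ x y : E, |x| ≤ |y| → ‖x‖ ≤ ‖y‖
  complete : @CompleteSpace E (NormedAddCommGroup.ofCore core).toUniformSpace

/-- The norm topology of a Banach lattice. -/
abbrev IsBanachLattice.normTopology {E : Type*} [AddCommGroup E] [Module ℝ E] [Lattice E] [Norm E]
    (h : IsBanachLattice E) : TopologicalSpace E :=
  (NormedAddCommGroup.ofCore h.core).toUniformSpace.toTopologicalSpace

/-- A locally convex-solid Hausdorff topology on a vector lattice: a Hausdorff vector space topology
which is locally convex and locally solid, i.e. the solid neighbourhoods of zero form a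
neighbourhood base at zero. -/
structure IsLocallyConvexSolidHausdorff {E : Type*} [AddCommGroup E] [Module ℝ E] [Lattice E]
    (τ : TopologicalSpace E) : Prop where
  t2 : T2Space E
  topologicalAddGroup : IsTopologicalAddGroup E
  continuousSMul : ContinuousSMul ℝ E
  locallyConvex : LocallyConvexSpace ℝ E
  locallySolid : ∀ U ∈ nhds (0 : E), ∃ V ∈ nhds (0 : E),
    V ⊆ U ∧ LatticeOrderedAddCommGroup.IsSolid V

/-- The Kreps–Yan property of `(E, τ)`: every convex cone `C ⊇ -E₊` whose `τ`-closure meets `E₊`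
only in zero admits a strictly positive `τ`-continuous linear functional that is nonpositive
on `C`. -/
def KrepsYanProperty {E : Type*} [AddCommGroup E] [Module ℝ E] [Lattice E]
    (τ : TopologicalSpace E) : Prop :=
  ∀ C : ConvexCone ℝ E, (∀ x : E, 0 ≤ x → -x ∈ C) →
    closure (C : Set E) ∩ {x | 0 ≤ x} = {0} →
    ∃ ξ : E →L[ℝ] ℝ, (∀ x : E, 0 < x → 0 < ξ x) ∧ ∀ x ∈ C, ξ x ≤ 0

end

/-! Write `J f` for the class of a bounded measurable `f`. For (b), the negative cone is closed in a
locally solid Hausdorff topology, so the Kreps–Yan property provides a strictly positive functional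
`ξ`. Then `A ↦ ξ (J 1_A)` is a finitely additive charge whose null events are exactly the polar
ones. Finite additivity is enough for an exhaustion that finds countably many members of `𝔓`
determining the polar events; a mixture of them dominates (`dominated_of_charge`). A Banach lattice
norm topology is locally convex-solid, so one half of (a) follows.

For the converse, domination gives a finite measure `μ` whose null events are the polar ones. The
core is `exists_pos_le_norm_sub_unitTests`: the tests `0 ≤ f ≤ 1` with `∫ f ∂μ ≥ ε` stay at positive
norm distance from the cone `C`. Otherwise tests approaching `C` can be chosen convergent a.e., by
convexity and near-minimal `L²` norms. Egorov makes the convergence uniform off a small set, and the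
remainder there is discarded because `C` contains the negative cone; the limit is a nonzero positive
element of the closure of `C`. Hahn–Banach then separates each of the countably many test sets `ε =
1/(n+1)`, and a weighted sum of the functionals is strictly positive. -/

noncomputable section

/-! ### Exhaustion, charges and domination -/

/-- Exhaustion: a bounded monotone set function attains its supremum on a nonempty family of sets
closed under countable unions. -/
theorem exists_forall_le_of_iUnion_mem {Ω : Type*} (S : Set (Set Ω)) (hne : S.Nonempty)
    (hU : ∀ f : ℕ → Set Ω, (∀ n, f n ∈ S) → ⋃ n, f n ∈ S) (m : Set Ω → ℝ)
    (hm : ∀ A ∈ S, ∀ B ∈ S, A ⊆ B → m A ≤ m B) (hb : BddAbove (m '' S)) :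
    ∃ N ∈ S, ∀ M ∈ S, m M ≤ m N := by
  obtain ⟨u, -, hu, hmem⟩ := exists_seq_tendsto_sSup (hne.image m) hb
  choose f hfS hfu using hmem
  refine ⟨⋃ n, f n, hU f hfS, fun M hM => (le_csSup hb ⟨M, hM, rfl⟩).trans ?_⟩
  refine le_of_tendsto' hu fun n => ?_
  rw [← hfu n]
  exact hm _ (hfS n) _ (hU f hfS) (Set.subset_iUnion f n)

namespace QuasiSure

variable {Ω : Type*} [MeasurableSpace Ω] {𝔓 : Set (ProbabilityMeasure Ω)}

theorem upperProb_eq_zero_iff {A : Set Ω} :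
    upperProb 𝔓 A = 0 ↔ ∀ P ∈ 𝔓, (P : Measure Ω) A = 0 := by
  simp [upperProb, ENNReal.iSup_eq_zero]

theorem upperProb_iUnion_eq_zero {f : ℕ → Set Ω} (h : ∀ n, upperProb 𝔓 (f n) = 0) :
    upperProb 𝔓 (⋃ n, f n) = 0 := by
  simp only [upperProb_eq_zero_iff] at h ⊢
  exact fun P hP => measure_iUnion_null fun n => h n P hP

/-- If a countable set of probability measures in `𝔓` determines the polar sets, then `𝔓` is
dominated. -/
theorem dominated_of_countable (h𝔓 : 𝔓.Nonempty) {T : Set (ProbabilityMeasure Ω)}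
    (hT : T.Countable) (h : ∀ N, MeasurableSet N → (∀ P ∈ T, (P : Measure Ω) N = 0) →
      upperProb 𝔓 N = 0) : Dominated 𝔓 := by
  obtain ⟨P₀, -⟩ := h𝔓
  -- `T` may be empty; adding `P₀` guarantees an enumeration.
  obtain ⟨P, hP⟩ := (hT.insert P₀).exists_eq_range (Set.insert_nonempty _ _)
  let Q : Measure Ω := Measure.sum fun n => ((2 : ENNReal)⁻¹ ^ (n + 1)) • (P n : Measure Ω)
  have hQ : IsProbabilityMeasure Q := by
    constructor
    rw [Measure.sum_apply _ MeasurableSet.univ]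
    simp [ENNReal.tsum_geometric_add_one, ENNReal.inv_mul_cancel]
  refine ⟨⟨Q, hQ⟩, fun N hN hQN => h N hN fun R hR => ?_⟩
  obtain ⟨n, rfl⟩ : R ∈ Set.range P := hP ▸ Set.mem_insert_of_mem _ hR
  have h0 : Q N = 0 := hQN
  rw [Measure.sum_apply _ hN, ENNReal.tsum_eq_zero] at h0
  have := h0 n
  rw [Measure.smul_apply, smul_eq_mul, mul_eq_zero] at this
  exact this.resolve_left (by simp)

/-- A set of probability measures whose polar sets are the null sets of a finitely additive
nonnegative set function is dominated. -/
theorem dominated_of_charge (h𝔓 : 𝔓.Nonempty) (m : Set Ω → ℝ)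
    (hadd : ∀ A B, MeasurableSet A → MeasurableSet B → Disjoint A B → m (A ∪ B) = m A + m B)
    (hpos : ∀ A, MeasurableSet A → 0 ≤ m A)
    (hzero : ∀ A, MeasurableSet A → m A = 0 → upperProb 𝔓 A = 0) : Dominated 𝔓 := by
  have hdiff : ∀ A B, MeasurableSet A → MeasurableSet B → m (A ∪ B) = m A + m (B \ A) := by
    intro A B hA hB
    rw [← hadd A (B \ A) hA (hB.diff hA) Set.disjoint_sdiff_right, Set.union_sdiff_self]
  have hmono : ∀ A B, MeasurableSet A → MeasurableSet B → A ⊆ B → m A ≤ m B := by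
    intro A B hA hB hAB
    have := hdiff A B hA hB
    rw [Set.union_eq_self_of_subset_left hAB] at this
    linarith [hpos _ (hB.diff hA)]
  have hbdd : ∀ S : Set (Set Ω), (∀ A ∈ S, MeasurableSet A) → BddAbove (m '' S) := by
    rintro S hS
    refine ⟨m Set.univ, ?_⟩
    rintro _ ⟨A, hA, rfl⟩
    exact hmono A _ (hS A hA) MeasurableSet.univ (Set.subset_univ A)
  -- A maximiser `N` of `m` is greatest up to polar sets: `m (N ∪ M) ≤ m N` forces `m (M \ N) = 0`.
  have hmax : ∀ S : Set (Set Ω), (∀ A ∈ S, MeasurableSet A) → S.Nonempty →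
      (∀ f : ℕ → Set Ω, (∀ n, f n ∈ S) → ⋃ n, f n ∈ S) → (∀ A ∈ S, ∀ B ∈ S, A ∪ B ∈ S) →
      ∃ N ∈ S, ∀ M ∈ S, upperProb 𝔓 (M \ N) = 0 := by
    intro S hS hne hU hU₂
    obtain ⟨N, hN, hle⟩ := exists_forall_le_of_iUnion_mem S hne hU m
      (fun A hA B hB => hmono A B (hS A hA) (hS B hB)) (hbdd S hS)
    refine ⟨N, hN, fun M hM => hzero _ ((hS M hM).diff (hS N hN)) (le_antisymm ?_ ?_)⟩
    · linarith [hle _ (hU₂ N hN M hM), hdiff N M (hS N hN) (hS M hM)]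
    · exact hpos _ ((hS M hM).diff (hS N hN))
  -- Events inside which countably many members of `𝔓` detect polarity. The aim is that a largest
  -- one is `Ω` up to a polar event.
  let D : Set (Set Ω) := {A | MeasurableSet A ∧ ∃ T ⊆ 𝔓, T.Countable ∧ ∀ N, MeasurableSet N →
    N ⊆ A → (∀ P ∈ T, (P : Measure Ω) N = 0) → upperProb 𝔓 N = 0}
  have hDU : ∀ f : ℕ → Set Ω, (∀ n, f n ∈ D) → ⋃ n, f n ∈ D := by
    intro f hf
    choose hfm T hT hTc h using hf
    refine ⟨MeasurableSet.iUnion hfm, ⋃ n, T n, Set.iUnion_subset hT, Set.countable_iUnion hTc, ?_⟩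
    intro N hN hNf hN0
    have : N = ⋃ n, N ∩ f n := by rw [← Set.inter_iUnion, Set.inter_eq_left.2 hNf]
    rw [this]
    refine upperProb_iUnion_eq_zero fun n => h n _ (hN.inter (hfm n)) Set.inter_subset_right ?_
    exact fun P hP => measure_mono_null Set.inter_subset_left (hN0 P (Set.mem_iUnion.2 ⟨n, hP⟩))
  have hDU₂ : ∀ A ∈ D, ∀ B ∈ D, A ∪ B ∈ D := by
    intro A hA B hB
    have := hDU (fun n => if n = 0 then A else B) (fun n => by split_ifs <;> assumption)
    convert this
    ext ω
    simp only [Set.mem_union, Set.mem_iUnion]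
    constructor
    · rintro (h | h)
      · exact ⟨0, by simpa using h⟩
      · exact ⟨1, by simpa using h⟩
    · rintro ⟨n, hn⟩
      split_ifs at hn
      exacts [Or.inl hn, Or.inr hn]
  obtain ⟨A, ⟨hAm, T, -, hTc, hT⟩, hA⟩ := hmax D (fun A hA => hA.1)
    ⟨∅, MeasurableSet.empty, ∅, Set.empty_subset _, Set.countable_empty, fun N _ hN _ => by
      rw [Set.subset_empty_iff.1 hN]; simp [upperProb]⟩ hDU hDU₂
  have hAc : upperProb 𝔓 Aᶜ = 0 := by
    refine upperProb_eq_zero_iff.2 fun P hP => ?_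
    obtain ⟨N, ⟨hNm, hPN⟩, hN⟩ := hmax {N | MeasurableSet N ∧ (P : Measure Ω) N = 0}
      (fun N hN => hN.1) ⟨∅, MeasurableSet.empty, measure_empty⟩
      (fun f hf => ⟨MeasurableSet.iUnion fun n => (hf n).1, measure_iUnion_null fun n => (hf n).2⟩)
      (fun A hA B hB => ⟨hA.1.union hB.1, measure_union_null hA.2 hB.2⟩)
    -- `N` is the largest `P`-null event up to polar sets, so `P` alone detects polarity inside
    -- `Nᶜ`. Hence `Nᶜ \ A` is polar, and `Aᶜ` is `P`-null.
    have hNc : Nᶜ ∈ D := by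
      refine ⟨hNm.compl, {P}, by simpa using hP, Set.countable_singleton P, fun M hM hMN hM0 => ?_⟩
      have := hN M ⟨hM, hM0 P rfl⟩
      rwa [(Set.subset_compl_iff_disjoint_right.1 hMN).sdiff_eq_left] at this
    refine measure_mono_null ?_ (measure_union_null hPN (upperProb_eq_zero_iff.1 (hA _ hNc) P hP))
    intro ω hω
    by_cases h : ω ∈ N
    exacts [Or.inl h, Or.inr ⟨h, hω⟩]
  refine dominated_of_countable h𝔓 hTc fun N hN hN0 => ?_
  have h1 := hT (N ∩ A) (hN.inter hAm) Set.inter_subset_right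
    fun P hP => measure_mono_null Set.inter_subset_left (hN0 P hP)
  rw [upperProb_eq_zero_iff] at h1 hAc ⊢
  intro P hP
  refine measure_mono_null ?_ (measure_union_null (h1 P hP) (hAc P hP))
  intro ω hω
  by_cases h : ω ∈ A
  exacts [Or.inl ⟨hω, h⟩, Or.inr h]

/-- A dominated set of probability measures has the same polar sets as some finite measure. -/
theorem Dominated.exists_measure (h : Dominated 𝔓) : ∃ μ : Measure Ω, IsFiniteMeasure μ ∧
    ∀ N, MeasurableSet N → (μ N = 0 ↔ upperProb 𝔓 N = 0) := by
  obtain ⟨Q, hQ⟩ := h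
  -- `Q` may charge polar events; cutting away a polar event of maximal `Q`-measure removes this.
  obtain ⟨M, ⟨hMm, hM0⟩, hM⟩ := exists_forall_le_of_iUnion_mem {N | IsPolar 𝔓 N}
    ⟨∅, MeasurableSet.empty, by simp [upperProb]⟩
    (fun f hf => ⟨MeasurableSet.iUnion fun n => (hf n).1,
      upperProb_iUnion_eq_zero fun n => (hf n).2⟩)
    (fun N => (Q : Measure Ω).real N) (fun A _ B _ hAB => measureReal_mono hAB)
    ⟨1, by rintro _ ⟨N, -, rfl⟩; exact measureReal_le_one⟩
  refine ⟨(Q : Measure Ω).restrict Mᶜ, inferInstance, fun N hN => ?_⟩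
  rw [Measure.restrict_apply hN]
  constructor
  · intro h0
    have h1 := hQ _ (hN.inter hMm.compl) h0
    rw [upperProb_eq_zero_iff] at h1 hM0 ⊢
    intro P hP
    refine measure_mono_null ?_ (measure_union_null (h1 P hP) (hM0 P hP))
    intro ω hω
    by_cases h : ω ∈ M
    exacts [Or.inr h, Or.inl ⟨hω, h⟩]
  · intro h0
    have h1 := hM (M ∪ N) (IsPolar.union ⟨hMm, hM0⟩ ⟨hN, h0⟩)
    rw [← Set.union_sdiff_self, measureReal_union Set.disjoint_sdiff_right (hN.diff hMm)] at h1
    have h2 : (Q : Measure Ω).real (N \ M) = 0 := le_antisymm (by linarith) measureReal_nonneg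
    exact (measureReal_eq_zero_iff).1 h2

end QuasiSure
end

/-! ### Near-minimal norms in Hilbert space and countable separation -/

noncomputable section
open Filter Topology in
/-- In a Hilbert space, elements of almost minimal norm of a decreasing bounded sequence of convex
sets form a Cauchy sequence. -/
theorem exists_cauchySeq_mem_of_antitone_convex {H : Type*} [NormedAddCommGroup H]
    [InnerProductSpace ℝ H] (D : ℕ → Set H) (hD : Antitone D) (hconv : ∀ n, Convex ℝ (D n))
    (hne : ∀ n, (D n).Nonempty) {R : ℝ} (hR : ∀ x ∈ D 0, ‖x‖ ≤ R) :
    ∃ y : ℕ → H, (∀ n, y n ∈ D n) ∧ CauchySeq y := by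
  have hbb : ∀ n, BddBelow ((fun x : H => ‖x‖ ^ 2) '' D n) := fun n =>
    ⟨0, by rintro _ ⟨x, -, rfl⟩; positivity⟩
  let d : ℕ → ℝ := fun n => sInf ((fun x : H => ‖x‖ ^ 2) '' D n)
  have hdle : ∀ n, ∀ x ∈ D n, d n ≤ ‖x‖ ^ 2 := fun n x hx => csInf_le (hbb n) ⟨x, hx, rfl⟩
  have hdmono : Monotone d := fun n m hnm =>
    csInf_le_csInf (hbb n) ((hne m).image _) (Set.image_mono (hD hnm))
  have hdbdd : BddAbove (Set.range d) := by
    refine ⟨R ^ 2, ?_⟩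
    rintro _ ⟨n, rfl⟩
    obtain ⟨x, hx⟩ := hne n
    have h0 := hR x (hD (Nat.zero_le n) hx)
    exact (hdle n x hx).trans (pow_le_pow_left₀ (norm_nonneg x) h0 2)
  have hex : ∀ n : ℕ, ∃ x ∈ D n, ‖x‖ ^ 2 < d n + 1 / ((n : ℝ) + 1) := by
    intro n
    obtain ⟨_, ⟨x, hx, rfl⟩, hlt⟩ := exists_lt_of_csInf_lt ((hne n).image fun x : H => ‖x‖ ^ 2)
      (lt_add_of_pos_right (d n) (by positivity : 0 < 1 / ((n : ℝ) + 1)))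
    exact ⟨x, hx, hlt⟩
  choose y hy hyd using hex
  refine ⟨y, hy, ?_⟩
  have hdt : Tendsto d atTop (𝓝 (⨆ n, d n)) := tendsto_atTop_ciSup hdmono hdbdd
  let s : ℝ := ⨆ n, d n
  -- The midpoint of `y n` and `y m` lies in `D n`, so its squared norm is at least `d n`; the
  -- parallelogram law gives the bound.
  have hkey : ∀ n m, n ≤ m → ‖y n - y m‖ ^ 2 ≤ 2 * (s - d n) + 4 * (1 / ((n : ℝ) + 1)) := by
    intro n m hnm
    have hmid : (1 / 2 : ℝ) • y n + (1 / 2 : ℝ) • y m ∈ D n :=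
      hconv n (hy n) (hD hnm (hy m)) (by norm_num) (by norm_num) (by norm_num)
    have h1 := hdle n _ hmid
    rw [← smul_add, norm_smul, mul_pow] at h1
    have h2 := parallelogram_law_with_norm ℝ (y n) (y m)
    have h3 : d m ≤ s := le_ciSup hdbdd m
    have h4 : 1 / ((m : ℝ) + 1) ≤ 1 / ((n : ℝ) + 1) :=
      one_div_le_one_div_of_le (by positivity) (by gcongr)
    have h5 : ‖(1 / 2 : ℝ)‖ ^ 2 = 1 / 4 := by norm_num
    rw [h5] at h1
    nlinarith [hyd n, hyd m]
  have hlim : Tendsto (fun n : ℕ => Real.sqrt (2 * (s - d n) + 4 * (1 / ((n : ℝ) + 1)))) atTop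
      (𝓝 0) := by
    have h1 : Tendsto (fun n : ℕ => 2 * (s - d n) + 4 * (1 / ((n : ℝ) + 1))) atTop
        (𝓝 (2 * (s - s) + 4 * 0)) :=
      ((hdt.const_sub s).const_mul 2).add (tendsto_one_div_add_atTop_nhds_zero_nat.const_mul 4)
    have h2 := h1.sqrt
    simpa using h2
  refine cauchySeq_of_le_tendsto_0' _ (fun n m hnm => ?_) hlim
  rw [dist_eq_norm]
  exact Real.le_sqrt_of_sq_le (hkey n m hnm)

/-- Countably many convex sets, each at positive distance from a convex cone, are separated from
that cone by a single continuous functional. -/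
theorem exists_separating_of_countable {E : Type*} [NormedAddCommGroup E] [NormedSpace ℝ E]
    (C : ConvexCone ℝ E) (h0 : (0 : E) ∈ C) (K : ℕ → Set E) (hK : ∀ n, Convex ℝ (K n))
    (hKC : ∀ n, ∀ x ∈ K n, -x ∈ C)
    (hd : ∀ n, ∃ δ > 0, ∀ x ∈ K n, ∀ c ∈ C, δ ≤ ‖x - c‖) :
    ∃ ξ : E →L[ℝ] ℝ, (∀ c ∈ C, ξ c ≤ 0) ∧ ∀ n, ∀ x ∈ K n, 0 < ξ x := by
  have hsep : ∀ n, ∃ ξ : E →L[ℝ] ℝ, (∀ c ∈ C, ξ c ≤ 0) ∧ ∀ x ∈ K n, 0 < ξ x := by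
    intro n
    obtain ⟨δ, hδ, hdist⟩ := hd n
    have hdisj : Disjoint (Metric.thickening δ (K n)) (C : Set E) := by
      rw [Set.disjoint_left]
      intro c hc hcC
      obtain ⟨x, hx, hlt⟩ := Metric.mem_thickening_iff.1 hc
      have := hdist x hx c hcC
      rw [dist_comm, dist_eq_norm] at hlt
      linarith
    obtain ⟨f, u, hu, huC⟩ := geometric_hahn_banach_open ((hK n).thickening δ)
      Metric.isOpen_thickening C.convex hdisj
    have hu0 : u ≤ 0 := by simpa using huC 0 h0
    refine ⟨-f, fun c hc => ?_, fun x hx => ?_⟩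
    · have : 0 ≤ f c := by
        -- A functional bounded below on a cone is nonnegative there: scaling `c` by a large `t`
        -- would push `f` below `u`.
        by_contra! hneg
        obtain ⟨t, ht⟩ := exists_nat_gt (u / f c)
        have ht' : (t : ℝ) * f c < u := by
          rwa [div_lt_iff_of_neg hneg] at ht
        rcases Nat.eq_zero_or_pos t with rfl | htp
        · have := huC 0 h0
          simp at ht' this
          linarith
        · have := huC _ (C.smul_mem (c := (t : ℝ)) (by exact_mod_cast htp) hc)
          rw [map_smul, smul_eq_mul] at this
          linarith
      simpa using this
    · have := hu x (Metric.self_subset_thickening hδ _ hx)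
      simp only [neg_apply]
      linarith
  choose ξ hξC hξK using hsep
  -- Positive weights that make the series absolutely convergent in the dual.
  let a : ℕ → ℝ := fun n => (1 / 2 : ℝ) ^ n / (1 + ‖ξ n‖)
  have ha : ∀ n, 0 < a n := fun n => by positivity
  have hsum : Summable fun n => a n • ξ n := by
    refine Summable.of_norm_bounded (g := fun n => (1 / 2 : ℝ) ^ n) summable_geometric_two
      fun n => ?_
    rw [norm_smul, Real.norm_of_nonneg (ha n).le, div_mul_eq_mul_div,
      div_le_iff₀ (by positivity)]
    gcongr
    linarith
  have happ : ∀ x, HasSum (fun n => a n * ξ n x) ((∑' n, a n • ξ n) x) := by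
    intro x
    simpa using (ContinuousLinearMap.apply ℝ ℝ x).hasSum hsum.hasSum
  refine ⟨∑' n, a n • ξ n, fun c hc => ?_, fun n x hx => ?_⟩
  · exact hasSum_le (fun n => mul_nonpos_of_nonneg_of_nonpos (ha n).le (hξC n c hc)) (happ c) hasSum_zero
  -- Since `-x ∈ C`, no functional is negative at `x`, so the positive `n`-th term cannot be
  -- cancelled.
  · have hnn : ∀ k, 0 ≤ a k * ξ k x := fun k => mul_nonneg (ha k).le (by
      have := hξC k _ (hKC n x hx)
      rw [map_neg] at this
      linarith)
    exact (mul_pos (ha n) (hξK n x hx)).trans_le (le_hasSum (happ x) n fun k _ => hnn k)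
end

/-! ### Kreps–Yan separation on bounded measurable functions -/

noncomputable section

open Filter Topology

/-- The space of bounded measurable functions. -/
def boundedMeasurable (Ω : Type*) [MeasurableSpace Ω] : Submodule ℝ (Ω → ℝ) where
  carrier := {f | Measurable f ∧ ∃ m : ℝ, 0 < m ∧ ∀ ω, |f ω| ≤ m}
  zero_mem' := ⟨measurable_const, 1, one_pos, fun ω => by simp⟩
  add_mem' := by
    rintro f g ⟨hf, m, hm, hfm⟩ ⟨hg, k, hk, hgk⟩
    exact ⟨hf.add hg, m + k, add_pos hm hk,
      fun ω => (abs_add_le _ _).trans (add_le_add (hfm ω) (hgk ω))⟩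
  smul_mem' := by
    rintro c f ⟨hf, m, hm, hfm⟩
    refine ⟨hf.const_smul c, |c| * m + 1, by positivity, fun ω => ?_⟩
    rw [Pi.smul_apply, smul_eq_mul, abs_mul]
    nlinarith [abs_nonneg c, hfm ω, mul_le_mul_of_nonneg_left (hfm ω) (abs_nonneg c)]

/-- Measurable functions with values in `[0, 1]` whose integral is at least `ε`. -/
def unitTests {Ω : Type*} [MeasurableSpace Ω] (μ : Measure Ω) (ε : ℝ) :
    Set (boundedMeasurable Ω) :=
  {f | (∀ ω, 0 ≤ f.1 ω) ∧ (∀ ω, f.1 ω ≤ 1) ∧ ε ≤ ∫ ω, f.1 ω ∂μ}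

section

variable {Ω : Type*} [MeasurableSpace Ω] {μ : Measure Ω} [IsFiniteMeasure μ]

theorem integrable_boundedMeasurable (f : boundedMeasurable Ω) : Integrable f.1 μ := by
  obtain ⟨m, -, h⟩ := f.2.2
  exact Integrable.of_bound f.2.1.aestronglyMeasurable m (Eventually.of_forall h)

theorem convex_unitTests (ε : ℝ) : Convex ℝ (unitTests μ ε) := by
  rintro f ⟨hf0, hf1, hf⟩ g ⟨hg0, hg1, hg⟩ a b ha hb hab
  refine ⟨fun ω => ?_, fun ω => ?_, ?_⟩
  · exact add_nonneg (mul_nonneg ha (hf0 ω)) (mul_nonneg hb (hg0 ω))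
  · change a * f.1 ω + b * g.1 ω ≤ 1
    nlinarith [hf1 ω, hg1 ω, hf0 ω, hg0 ω]
  · change ε ≤ ∫ ω, (a * f.1 ω + b * g.1 ω) ∂μ
    rw [integral_add ((integrable_boundedMeasurable f).const_mul a)
      ((integrable_boundedMeasurable g).const_mul b),
      integral_const_mul, integral_const_mul]
    calc ε = a * ε + b * ε := by rw [← add_mul, hab, one_mul]
      _ ≤ _ := by gcongr

/-- A sequence of convex conditions, each satisfied by some function in `unitTests μ ε` and
becoming stronger, is satisfied along a sequence that converges almost everywhere. -/
theorem exists_seq_unitTests_tendsto_ae {ε : ℝ} (K : ℕ → Set (boundedMeasurable Ω))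
    (hK : Antitone K) (hconv : ∀ n, Convex ℝ (K n)) (hne : ∀ n, (K n).Nonempty)
    (hKε : K 0 ⊆ unitTests μ ε) :
    ∃ (f : ℕ → boundedMeasurable Ω) (g : Ω → ℝ), (∀ n, f n ∈ K n) ∧ Measurable g ∧
      ∀ᵐ ω ∂μ, Tendsto (fun n => (f n).1 ω) atTop (𝓝 (g ω)) := by
  have hle : ∀ n, K n ⊆ unitTests μ ε := fun n => (hK (Nat.zero_le n)).trans hKε
  have hLp : ∀ f : boundedMeasurable Ω, MemLp f.1 2 μ := by
    intro f
    obtain ⟨m, -, h⟩ := f.2.2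
    exact MemLp.of_bound f.2.1.aestronglyMeasurable m (Eventually.of_forall h)
  let D : ℕ → Set (Lp ℝ 2 μ) := fun n => (fun f => (hLp f).toLp f.1) '' K n
  obtain ⟨R, hR⟩ : ∃ R : ℝ, ∀ x ∈ D 0, ‖x‖ ≤ R := by
    refine ⟨(measureUnivNNReal μ : ℝ) ^ (2 : ENNReal).toReal⁻¹ * 1, ?_⟩
    rintro _ ⟨f, hf, rfl⟩
    refine Lp.norm_le_of_ae_bound zero_le_one ?_
    filter_upwards [(hLp f).coeFn_toLp] with ω hω
    rw [hω, Real.norm_of_nonneg ((hle 0 hf).1 ω)]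
    exact (hle 0 hf).2.1 ω
  have hDconv : ∀ n, Convex ℝ (D n) := by
    rintro n _ ⟨f, hf, rfl⟩ _ ⟨g, hg, rfl⟩ a b ha hb hab
    exact ⟨a • f + b • g, hconv n hf hg ha hb hab, rfl⟩
  obtain ⟨y, hyD, hy⟩ := exists_cauchySeq_mem_of_antitone_convex D
    (fun n m hnm => Set.image_mono (hK hnm)) hDconv (fun n => (hne n).image _) hR
  obtain ⟨h, hh⟩ := cauchySeq_tendsto_of_complete hy
  choose f hf hfy using hyD
  obtain ⟨ns, hns, hae⟩ := (tendstoInMeasure_of_tendsto_Lp hh).exists_seq_tendsto_ae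
  -- `L²` convergence gives a.e. convergence only along a subsequence; as `n ≤ ns n` and `K`
  -- decreases, membership in `K n` survives.
  refine ⟨fun n => f (ns n), h, fun n => hK (hns.id_le n) (hf (ns n)),
    (Lp.stronglyMeasurable h).measurable, ?_⟩
  have hall : ∀ᵐ ω ∂μ, ∀ n, y n ω = (f n).1 ω := by
    rw [ae_all_iff]
    intro n
    rw [← hfy n]
    exact (hLp (f n)).coeFn_toLp
  filter_upwards [hae, hall] with ω h1 h2
  simpa only [h2] using h1

/-- Uniform version of the no-free-lunch property: a convex cone whose closure contains no
nonzero positive bounded function has positive distance from the functions in `[0, 1]` whose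
integral is bounded away from zero. -/
theorem exists_pos_le_norm_sub_unitTests {E : Type*} [NormedAddCommGroup E] [NormedSpace ℝ E]
    (J : boundedMeasurable Ω →ₗ[ℝ] E) {R : ℝ}
    (hJ : ∀ f m, 0 ≤ m → (∀ ω, |f.1 ω| ≤ m) → ‖J f‖ ≤ m * R)
    (C : ConvexCone ℝ E) (hC : ∀ f : boundedMeasurable Ω, (∀ ω, 0 ≤ f.1 ω) → -J f ∈ C)
    (hcl : ∀ f : boundedMeasurable Ω, (∀ ω, 0 ≤ f.1 ω) → J f ∈ closure (C : Set E) →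
      f.1 =ᵐ[μ] 0) {ε : ℝ} (hε : 0 < ε) :
    ∃ δ > 0, ∀ x ∈ J '' unitTests μ ε, ∀ c ∈ C, δ ≤ ‖x - c‖ := by
  by_contra! hcon
  let K : ℕ → Set (boundedMeasurable Ω) := fun n =>
    {f | f ∈ unitTests μ ε ∧ ∃ c ∈ C, ‖J f - c‖ < 1 / ((n : ℝ) + 1)}
  obtain ⟨f, g, hfK, hg, hae⟩ := exists_seq_unitTests_tendsto_ae (μ := μ) (ε := ε) K
    (by
      rintro n m hnm f ⟨hf, c, hc, hlt⟩
      exact ⟨hf, c, hc, hlt.trans_le (one_div_le_one_div_of_le (by positivity) (by gcongr))⟩)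
    (by
      rintro n f ⟨hf, c, hc, hfc⟩ f' ⟨hf', c', hc', hfc'⟩ a b ha hb hab
      refine ⟨convex_unitTests ε hf hf' ha hb hab, a • c + b • c', C.convex hc hc' ha hb hab, ?_⟩
      have h1 : a • (J f - c) + b • (J f' - c') ∈ Metric.ball (0 : E) (1 / ((n : ℝ) + 1)) :=
        convex_ball _ _ (by simpa using hfc) (by simpa using hfc') ha hb hab
      rw [mem_ball_zero_iff] at h1
      have h2 : J (a • f + b • f') - (a • c + b • c') = a • (J f - c) + b • (J f' - c') := by
        rw [map_add, map_smul, map_smul]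
        module
      rwa [h2])
    (by
      intro n
      obtain ⟨_, ⟨f, hf, rfl⟩, c, hc, hlt⟩ := hcon (1 / ((n : ℝ) + 1)) (by positivity)
      exact ⟨f, hf, c, hc, hlt⟩)
    (fun f hf => hf.1)
  have hf0 : ∀ n ω, 0 ≤ (f n).1 ω := fun n => (hfK n).1.1
  have hf1 : ∀ n ω, (f n).1 ω ≤ 1 := fun n => (hfK n).1.2.1
  have hg0 : ∀ᵐ ω ∂μ, 0 ≤ g ω := by
    filter_upwards [hae] with ω hω using ge_of_tendsto' hω fun n => hf0 n ω
  have hg1 : ∀ᵐ ω ∂μ, g ω ≤ 1 := by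
    filter_upwards [hae] with ω hω using le_of_tendsto' hω fun n => hf1 n ω
  have hgi : Integrable g μ := by
    refine Integrable.of_bound hg.aestronglyMeasurable 1 ?_
    filter_upwards [hg0, hg1] with ω h0 h1
    rwa [Real.norm_of_nonneg h0]
  have hint : ε ≤ ∫ ω, g ω ∂μ := by
    refine ge_of_tendsto' (tendsto_integral_of_dominated_convergence (fun _ => (1 : ℝ))
      (fun n => (f n).2.1.aestronglyMeasurable) (integrable_const 1) (fun n => ?_) hae)
      fun n => (hfK n).1.2.2
    refine Eventually.of_forall fun ω => ?_
    rw [Real.norm_of_nonneg (hf0 n ω)]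
    exact hf1 n ω
  -- Egorov with exceptional mass `ε / 2`: as `g ≤ 1` a.e., the integral of `g` over `tᶜ` is still
  -- at least `ε / 2`.
  obtain ⟨t, htm, htμ, hunif⟩ := tendstoUniformlyOn_of_ae_tendsto'
    (fun n => (f n).2.1.stronglyMeasurable) hg.stronglyMeasurable hae (half_pos hε)
  have hgt : ∀ ω ∈ tᶜ, Tendsto (fun n => (f n).1 ω) atTop (𝓝 (g ω)) :=
    fun ω hω => hunif.tendsto_at hω
  have hgt0 : ∀ ω ∈ tᶜ, 0 ≤ g ω := fun ω hω => ge_of_tendsto' (hgt ω hω) fun n => hf0 n ω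
  have hgt1 : ∀ ω ∈ tᶜ, g ω ≤ 1 := fun ω hω => le_of_tendsto' (hgt ω hω) fun n => hf1 n ω
  let x : boundedMeasurable Ω := ⟨tᶜ.indicator g, hg.indicator htm.compl, 1, one_pos, fun ω => by
    by_cases hω : ω ∈ tᶜ
    · rw [Set.indicator_of_mem hω, abs_of_nonneg (hgt0 ω hω)]
      exact hgt1 ω hω
    · rw [Set.indicator_of_notMem hω]
      simp⟩
  have hx0 : ∀ ω, 0 ≤ x.1 ω := fun ω => Set.indicator_nonneg hgt0 ω
  -- The part of `f n` on `t`, where convergence is not controlled; `-J (r n) ∈ C` lets it be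
  -- subtracted inside the cone.
  let r : ℕ → boundedMeasurable Ω := fun n => ⟨t.indicator (f n).1, (f n).2.1.indicator htm, 1,
    one_pos, fun ω => by
      by_cases hω : ω ∈ t
      · rw [Set.indicator_of_mem hω, abs_of_nonneg (hf0 n ω)]
        exact hf1 n ω
      · rw [Set.indicator_of_notMem hω]
        simp⟩
  have hr0 : ∀ n ω, 0 ≤ (r n).1 ω := fun n ω => Set.indicator_nonneg (fun ω _ => hf0 n ω) ω
  have hxC : J x ∈ closure (C : Set E) := by
    rw [Metric.mem_closure_iff]
    intro η hη
    obtain ⟨η', hη', hη'R⟩ : ∃ η' > 0, η' * |R| < η / 2 := by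
      refine ⟨η / 2 / (|R| + 1), by positivity, ?_⟩
      rw [div_mul_eq_mul_div, div_lt_iff₀ (by positivity)]
      nlinarith [abs_nonneg R]
    obtain ⟨n, hn1, hn2⟩ := (((Metric.tendstoUniformlyOn_iff.1 hunif) η' hη').and
      ((tendsto_one_div_add_atTop_nhds_zero_nat (𝕜 := ℝ)).eventually_lt_const
        (half_pos hη))).exists
    obtain ⟨c, hc, hlt⟩ := (hfK n).2
    refine ⟨c + -J (r n), C.add_mem hc (hC _ (hr0 n)), ?_⟩
    -- `x + r n - f n` vanishes on `t` and equals `g - f n` on `tᶜ`, hence is uniformly small.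
    have h1 : ‖J (x + r n - f n)‖ ≤ η' * |R| := by
      refine (hJ _ η' hη'.le fun ω => ?_).trans (by gcongr; exact le_abs_self R)
      change |tᶜ.indicator g ω + t.indicator (f n).1 ω - (f n).1 ω| ≤ η'
      by_cases hω : ω ∈ t
      · rw [Set.indicator_of_mem hω, Set.indicator_of_notMem (by simpa using hω)]
        simpa using hη'.le
      · rw [Set.indicator_of_notMem hω, Set.indicator_of_mem (by simpa using hω), add_zero]
        exact (hn1 ω hω).le
    have h2 : J x - (c + -J (r n)) = J (x + r n - f n) + (J (f n) - c) := by
      rw [map_sub, map_add]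
      abel
    rw [dist_eq_norm, h2]
    exact (norm_add_le _ _).trans_lt (by linarith)
  have hx := hcl x hx0 hxC
  have h1 : ∫ ω in tᶜ, g ω ∂μ = 0 := by
    rw [← integral_indicator htm.compl]
    exact integral_eq_zero_of_ae hx
  have h2 : ∫ ω in t, g ω ∂μ ≤ ε / 2 := by
    calc ∫ ω in t, g ω ∂μ ≤ ∫ ω in t, (1 : ℝ) ∂μ :=
          integral_mono_ae hgi.restrict (integrable_const 1) (ae_restrict_of_ae hg1)
      _ = μ.real t := by simp
      _ ≤ ε / 2 := ENNReal.toReal_le_of_le_ofReal (half_pos hε).le htμ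
  have h3 := integral_add_compl htm hgi
  linarith

/-- Kreps–Yan theorem on bounded functions. -/
theorem exists_functional_pos_on_indicators {E : Type*} [NormedAddCommGroup E] [NormedSpace ℝ E]
    (J : boundedMeasurable Ω →ₗ[ℝ] E) {R : ℝ}
    (hJ : ∀ f m, 0 ≤ m → (∀ ω, |f.1 ω| ≤ m) → ‖J f‖ ≤ m * R)
    (C : ConvexCone ℝ E) (hC : ∀ f : boundedMeasurable Ω, (∀ ω, 0 ≤ f.1 ω) → -J f ∈ C)
    (hcl : ∀ f : boundedMeasurable Ω, (∀ ω, 0 ≤ f.1 ω) → J f ∈ closure (C : Set E) →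
      f.1 =ᵐ[μ] 0) :
    ∃ ξ : E →L[ℝ] ℝ, (∀ c ∈ C, ξ c ≤ 0) ∧
      ∀ f : boundedMeasurable Ω, (∀ ω, 0 ≤ f.1 ω) → (∀ ω, f.1 ω ≤ 1) → 0 < ∫ ω, f.1 ω ∂μ →
        0 < ξ (J f) := by
  obtain ⟨ξ, hξC, hξ⟩ := exists_separating_of_countable C (by simpa using hC 0 fun _ => le_rfl)
    (fun n : ℕ => J '' unitTests μ (1 / ((n : ℝ) + 1)))
    (fun n => (convex_unitTests _).linear_image J)
    (by rintro n _ ⟨f, hf, rfl⟩; exact hC f hf.1)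
    (fun n => exists_pos_le_norm_sub_unitTests J hJ C hC hcl (by positivity))
  refine ⟨ξ, hξC, fun f hf0 hf1 hf => ?_⟩
  obtain ⟨n, hn⟩ := exists_nat_one_div_lt hf
  exact hξ n _ ⟨f, ⟨hf0, hf1, hn.le⟩, rfl⟩

end
end

/-! ### Strictly positive functionals on vector lattices -/

noncomputable section

section

variable {E : Type*} [AddCommGroup E] [Module ℝ E] [Lattice E]

instance (X : VectorLatticeIdeal E) [IsOrderedAddMonoid E] : IsOrderedAddMonoid X where
  add_le_add_left _ _ h c := add_le_add_left (α := E) h c.1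

instance (X : VectorLatticeIdeal E) [IsOrderedAddMonoid E] [PosSMulMono ℝ E] :
    PosSMulMono ℝ X where
  smul_le_smul_of_nonneg_left _ ha _ _ h := smul_le_smul_of_nonneg_left (β := E) h ha

/-- The norm topology of a Banach lattice is locally convex-solid and Hausdorff. -/
theorem IsBanachLattice.isLocallyConvexSolidHausdorff [Norm E] (h : IsBanachLattice E) :
    IsLocallyConvexSolidHausdorff h.normTopology := by
  let _ : NormedAddCommGroup E := NormedAddCommGroup.ofCore h.core
  let _ : NormedSpace ℝ E := NormedSpace.ofCore h.core
  refine ⟨inferInstance, inferInstance, inferInstance, NormedSpace.toLocallyConvexSpace, ?_⟩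
  intro U hU
  obtain ⟨ε, hε, hball⟩ := Metric.mem_nhds_iff.1 hU
  refine ⟨Metric.ball 0 ε, Metric.ball_mem_nhds 0 hε, hball, fun x hx y hyx => ?_⟩
  rw [mem_ball_zero_iff] at hx ⊢
  exact (h.solid y x hyx).trans_lt hx

variable [IsOrderedAddMonoid E]

/-- A vector lattice with a locally convex-solid Hausdorff topology and the Kreps–Yan property
admits a strictly positive linear functional. -/
theorem KrepsYanProperty.exists_strictlyPositive [PosSMulMono ℝ E] {τ : TopologicalSpace E}
    (hτ : IsLocallyConvexSolidHausdorff τ) (h : KrepsYanProperty τ) :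
    ∃ ξ : E →ₗ[ℝ] ℝ, ∀ x : E, 0 < x → 0 < ξ x := by
  let C : ConvexCone ℝ E :=
    { carrier := {x | x ≤ 0}
      smul_mem' := fun c hc x hx => by
        have := smul_le_smul_of_nonneg_left (show x ≤ 0 from hx) hc.le
        rwa [smul_zero] at this
      add_mem' := fun x hx y hy => add_nonpos hx hy }
  have h0 : (0 : E) ∈ (C : Set E) := le_refl (0 : E)
  obtain ⟨ξ, hξ, -⟩ := h C (fun x hx => neg_nonpos.2 hx) (by
    refine Set.Subset.antisymm ?_ (Set.singleton_subset_iff.2 ⟨subset_closure h0, le_refl (0 : E)⟩)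
    rintro x ⟨hxC, hx⟩
    have := hτ.t2
    have := hτ.topologicalAddGroup
    refine Set.mem_singleton_iff.2 (eq_of_nhds_neBot (x := x) (y := 0) ?_)
    by_contra hbot
    have hne : x ≠ 0 := by
      rintro rfl
      exact hbot (by rw [inf_idem]; infer_instance)
    -- Closedness of the negative cone: for `y ≤ 0` near `x ≥ 0`, `0 ≤ x ≤ x - y ∈ V`, so solidity
    -- puts `x` into `V`, which avoids it.
    obtain ⟨V, hV, hVx, hVs⟩ := hτ.locallySolid {x}ᶜ (compl_singleton_mem_nhds hne.symm)
    have hV' : {y | x - y ∈ V} ∈ nhds x := by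
      have : Filter.Tendsto (fun y => x - y) (nhds x) (nhds (x - x)) :=
        tendsto_const_nhds.sub Filter.tendsto_id
      rw [sub_self] at this
      exact this hV
    obtain ⟨y, hyV, hy⟩ := mem_closure_iff_nhds.1 hxC _ hV'
    have hxy : x ≤ x - y := le_sub_self_iff x |>.2 hy
    refine hVx (hVs hyV (y := x) ?_) rfl
    rwa [abs_of_nonneg hx, abs_of_nonneg (le_trans hx hxy)])
  exact ⟨ξ, hξ⟩

end

/-! ### Ideals of `L⁰_c` containing the bounded classes -/

namespace QuasiSure

variable {Ω : Type*} [MeasurableSpace Ω] {𝔓 : Set (ProbabilityMeasure Ω)}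

/-- Serves both to place bounded functions in the ideal and to bound their norms by that of `1_Ω`.
-/
theorem L0.abs_mk_le {f : MeasurableFun Ω} {m : ℝ} (h : ∀ ω, |f.1 ω| ≤ m) :
    |L0.mk 𝔓 f| ≤ m • (1 : L0 𝔓) := by
  have h1 : m • (1 : L0 𝔓) = L0.mk 𝔓 (m • ⟨fun _ => 1, measurable_const⟩) := (map_smul _ _ _).symm
  rw [h1, abs_le', ← map_neg]
  constructor
  · refine L0.mk_le_mk.2 (QS.of_forall fun ω => ?_)
    simpa using (le_abs_self _).trans (h ω)
  · refine L0.mk_le_mk.2 (QS.of_forall fun ω => ?_)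
    simpa using (neg_le_abs _).trans (h ω)

theorem L0.mk_nonneg {f : MeasurableFun Ω} : 0 ≤ L0.mk 𝔓 f ↔ QS 𝔓 (fun ω => 0 ≤ f.1 ω) := by
  rw [← map_zero (L0.mk 𝔓)]
  exact L0.mk_le_mk

/-- The class of a bounded measurable function, in an ideal that contains `L^∞_c`. -/
def boundedToIdeal (X : VectorLatticeIdeal (L0 𝔓))
    (hX : Linfty 𝔓 ⊆ (X.toSubmodule : Set (L0 𝔓))) : boundedMeasurable Ω →ₗ[ℝ] X where
  toFun f := ⟨L0.mk 𝔓 ⟨f.1, f.2.1⟩, hX (by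
    obtain ⟨m, hm, h⟩ := f.2.2
    exact ⟨m, hm, L0.abs_mk_le h⟩)⟩
  map_add' f g := Subtype.ext (map_add (L0.mk 𝔓) ⟨f.1, f.2.1⟩ ⟨g.1, g.2.1⟩)
  map_smul' c f := Subtype.ext (map_smul (L0.mk 𝔓) c ⟨f.1, f.2.1⟩)

/-- The indicator function of a measurable set as a bounded measurable function. -/
def boundedIndicator {A : Set Ω} (hA : MeasurableSet A) : boundedMeasurable Ω :=
  ⟨A.indicator fun _ => 1, measurable_const.indicator hA, 1, one_pos, fun ω => by
    by_cases h : ω ∈ A <;> simp [h]⟩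

section

variable (X : VectorLatticeIdeal (L0 𝔓)) (hX : Linfty 𝔓 ⊆ (X.toSubmodule : Set (L0 𝔓)))

theorem boundedToIdeal_nonneg {f : boundedMeasurable Ω} (hf : ∀ ω, 0 ≤ f.1 ω) :
    0 ≤ boundedToIdeal X hX f :=
  L0.mk_nonneg.2 (QS.of_forall hf)

theorem boundedToIdeal_indicator_eq_zero {A : Set Ω} (hA : MeasurableSet A) :
    boundedToIdeal X hX (boundedIndicator hA) = 0 ↔ upperProb 𝔓 A = 0 := by
  have h1 : boundedToIdeal X hX (boundedIndicator hA) = 0 ↔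
      L0.mk 𝔓 ⟨_, (boundedIndicator hA).2.1⟩ = L0.mk 𝔓 0 := by
    rw [map_zero]
    exact Subtype.ext_iff
  rw [h1, L0.mk_eq_mk]
  refine (qs_eq_zero_iff (boundedIndicator hA).2.1).symm.trans ?_
  have : {ω | 0 < |(boundedIndicator hA).1 ω|} = A := by
    ext ω
    by_cases h : ω ∈ A <;> simp [boundedIndicator, h]
  rw [this]

/-- Every strictly positive element dominates a positive multiple of the indicator of a
non-polar event. -/
theorem exists_smul_indicator_le {x : X} (hx : 0 < x) :
    ∃ (A : Set Ω) (hA : MeasurableSet A) (r : ℝ), 0 < r ∧ upperProb 𝔓 A ≠ 0 ∧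
      r • boundedToIdeal X hX (boundedIndicator hA) ≤ x := by
  obtain ⟨x, hxX⟩ := x
  obtain ⟨f, rfl⟩ := L0.mk_surjective x
  have hf : QS 𝔓 (fun ω => 0 ≤ f.1 ω) := L0.mk_nonneg.1 hx.le
  by_contra! hcon
  -- If all these level sets were polar, so would be their union `{f > 0}`, contradicting `0 < x`.
  have hA : ∀ n : ℕ, MeasurableSet {ω | 1 / ((n : ℝ) + 1) ≤ f.1 ω} :=
    fun n => measurableSet_le measurable_const f.2
  have hpolar : ∀ n : ℕ, upperProb 𝔓 {ω | 1 / ((n : ℝ) + 1) ≤ f.1 ω} = 0 := by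
    intro n
    by_contra hne
    refine hcon _ (hA n) (1 / ((n : ℝ) + 1)) (by positivity) hne ?_
    change (1 / ((n : ℝ) + 1)) • L0.mk 𝔓 ⟨_, (boundedIndicator (hA n)).2.1⟩ ≤ L0.mk 𝔓 f
    rw [← map_smul]
    refine L0.mk_le_mk.2 (hf.mono fun ω hω => ?_)
    by_cases h : 1 / ((n : ℝ) + 1) ≤ f.1 ω
    · rw [one_div] at h
      simpa [boundedIndicator, Set.indicator, if_pos h] using h
    · rw [one_div] at h
      simpa [boundedIndicator, Set.indicator, if_neg h] using hω
  have hle : (⟨L0.mk 𝔓 f, hxX⟩ : X) ≤ 0 := by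
    change L0.mk 𝔓 f ≤ 0
    rw [← map_zero (L0.mk 𝔓)]
    refine L0.mk_le_mk.2 ⟨_, ⟨MeasurableSet.iUnion hA, upperProb_iUnion_eq_zero hpolar⟩, ?_⟩
    intro ω hω
    by_contra! hpos
    obtain ⟨n, hn⟩ := exists_nat_one_div_lt (show 0 < f.1 ω from hpos)
    exact hω (Set.mem_iUnion.2 ⟨n, hn.le⟩)
  exact absurd hx (not_lt_of_ge hle)

end

/-- A strictly positive linear functional on an ideal containing `L^∞_c` forces domination. -/
theorem dominated_of_strictlyPositive
    (X : VectorLatticeIdeal (L0 𝔓)) (hX : Linfty 𝔓 ⊆ (X.toSubmodule : Set (L0 𝔓))) (h𝔓 : 𝔓.Nonempty) (ξ : X →ₗ[ℝ] ℝ)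
    (hξ : ∀ x : X, 0 < x → 0 < ξ x) : Dominated 𝔓 := by
  classical
  -- The value `0` at nonmeasurable sets is a dummy; only events are tested.
  let m : Set Ω → ℝ := fun A =>
    if hA : MeasurableSet A then ξ (boundedToIdeal X hX (boundedIndicator hA)) else 0
  have hm : ∀ A (hA : MeasurableSet A),
      m A = ξ (boundedToIdeal X hX (boundedIndicator hA)) := fun A hA => dif_pos hA
  have hnn : ∀ A (hA : MeasurableSet A), 0 ≤ boundedToIdeal X hX (boundedIndicator hA) :=
    fun A hA => boundedToIdeal_nonneg X hX
      fun ω => Set.indicator_nonneg (fun _ _ => zero_le_one) ω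
  refine dominated_of_charge h𝔓 m (fun A B hA hB hAB => ?_) (fun A hA => ?_) (fun A hA h => ?_)
  · rw [hm _ (hA.union hB), hm _ hA, hm _ hB, ← map_add, ← map_add]
    congr 2
    exact Subtype.ext (Set.indicator_union_of_disjoint hAB _)
  · rw [hm _ hA]
    rcases (hnn A hA).eq_or_lt with h | h
    · rw [← h, map_zero]
    · exact (hξ _ h).le
  · rw [hm _ hA] at h
    rw [← boundedToIdeal_indicator_eq_zero X hX hA]
    by_contra hne
    exact (hξ _ (lt_of_le_of_ne (hnn A hA) (Ne.symm hne))).ne' h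

/-- Kreps–Yan theorem for ideals of `L⁰_c` with a Banach lattice norm. -/
theorem Dominated.krepsYanProperty (X : VectorLatticeIdeal (L0 𝔓))
    (hX : Linfty 𝔓 ⊆ (X.toSubmodule : Set (L0 𝔓))) [Norm X] (hN : IsBanachLattice X) (h : Dominated 𝔓) :
    KrepsYanProperty hN.normTopology := by
  let _ : NormedAddCommGroup X := NormedAddCommGroup.ofCore hN.core
  let _ : NormedSpace ℝ X := NormedSpace.ofCore hN.core
  intro C hC hcl
  obtain ⟨μ, hμ, hμ0⟩ := h.exists_measure
  let J : boundedMeasurable Ω →ₗ[ℝ] X := boundedToIdeal X hX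
  have hJ0 : ∀ f : boundedMeasurable Ω, (∀ ω, 0 ≤ f.1 ω) → 0 ≤ J f :=
    fun f hf => boundedToIdeal_nonneg X hX hf
  let e : X := J (boundedIndicator MeasurableSet.univ)
  have hJ : ∀ (f : boundedMeasurable Ω) (m : ℝ), 0 ≤ m → (∀ ω, |f.1 ω| ≤ m) →
      ‖J f‖ ≤ m * ‖e‖ := by
    intro f m hm hf
    have h1 : |J f| ≤ |m • e| := by
      refine le_trans ?_ (le_abs_self _)
      refine (L0.abs_mk_le (f := ⟨f.1, f.2.1⟩) hf).trans_eq ?_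
      have h1 : (1 : L0 𝔓) = L0.mk 𝔓 ⟨_, (boundedIndicator MeasurableSet.univ).2.1⟩ :=
        congrArg (L0.mk 𝔓) (Subtype.ext (Set.indicator_univ _).symm)
      rw [h1]
      rfl
    have h2 := hN.solid _ _ h1
    rwa [norm_smul, Real.norm_of_nonneg hm] at h2
  obtain ⟨ξ, hξC, hξ⟩ := exists_functional_pos_on_indicators (μ := μ) J hJ C
    (fun f hf => hC _ (hJ0 f hf)) (fun f hf hfC => by
      -- The closure condition gives `J f = 0`, i.e. `f = 0` off a polar event, which is `μ`-null.
      have h1 : J f ∈ ({0} : Set X) := hcl ▸ ⟨hfC, hJ0 f hf⟩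
      have h2 : L0.mk 𝔓 ⟨f.1, f.2.1⟩ = L0.mk 𝔓 0 := by
        rw [map_zero]
        exact congrArg Subtype.val (Set.mem_singleton_iff.1 h1)
      obtain ⟨N, hNp, hN0⟩ := L0.mk_eq_mk.1 h2
      have h3 : μ N = 0 := (hμ0 N hNp.1).2 hNp.2
      filter_upwards [measure_eq_zero_iff_ae_notMem.1 h3] with ω hω using hN0 ω hω)
  refine ⟨ξ, fun x hx => ?_, hξC⟩
  obtain ⟨A, hA, r, hr, hAp, hle⟩ := exists_smul_indicator_le X hX hx
  have h1 : 0 < ξ (J (boundedIndicator hA)) := by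
    refine hξ _ (fun ω => Set.indicator_nonneg (fun _ _ => zero_le_one) ω)
      (fun ω => Set.indicator_le_self' (fun _ _ => zero_le_one) ω) ?_
    have : ∫ ω, (boundedIndicator hA).1 ω ∂μ = μ.real A := by
      simp [boundedIndicator, integral_indicator hA]
    rw [this]
    exact ENNReal.toReal_pos (fun h0 => hAp ((hμ0 A hA).1 h0)) (measure_ne_top μ A)
  -- `C` contains the negative cone, so `ξ` is monotone and `ξ x ≥ r * ξ (J 1_A) > 0`.
  have h2 : ξ (-(x - r • J (boundedIndicator hA))) ≤ 0 := hξC _ (hC _ (sub_nonneg.2 hle))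
  rw [map_neg, map_sub, map_smul, smul_eq_mul] at h2
  linarith [mul_pos hr h1]

end QuasiSure

end

theorem corollary5p8 {Ω : Type*} [MeasurableSpace Ω] (𝔓 : Set (ProbabilityMeasure Ω))
    (h𝔓 : 𝔓.Nonempty) :
    (∀ (X : VectorLatticeIdeal (QuasiSure.L0 𝔓)) [Norm X] (hX : IsBanachLattice X),
      QuasiSure.Linfty 𝔓 ⊆ (X.toSubmodule : Set (QuasiSure.L0 𝔓)) →
      (QuasiSure.Dominated 𝔓 ↔ KrepsYanProperty hX.normTopology)) ∧
    (∀ (X : VectorLatticeIdeal (QuasiSure.L0 𝔓)) (τ : TopologicalSpace X),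
      QuasiSure.Linfty 𝔓 ⊆ (X.toSubmodule : Set (QuasiSure.L0 𝔓)) →
      IsLocallyConvexSolidHausdorff τ → KrepsYanProperty τ → QuasiSure.Dominated 𝔓) := by
  have hb : ∀ (X : VectorLatticeIdeal (QuasiSure.L0 𝔓)) (τ : TopologicalSpace X),
      QuasiSure.Linfty 𝔓 ⊆ (X.toSubmodule : Set (QuasiSure.L0 𝔓)) →
      IsLocallyConvexSolidHausdorff τ → KrepsYanProperty τ → QuasiSure.Dominated 𝔓 := by
    intro X τ hX hτ hKY
    obtain ⟨ξ, hξ⟩ := hKY.exists_strictlyPositive hτ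
    exact QuasiSure.dominated_of_strictlyPositive X hX h𝔓 ξ hξ
  refine ⟨fun X _ hX hL => ⟨fun h => h.krepsYanProperty X hL hX, fun h => ?_⟩, hb⟩
  exact hb X _ hL hX.isLocallyConvexSolidHausdorff h
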